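/- Let $\mathcal A$ be a unital $C^*$-algebra with centre $Z(\mathcal A)$, and let $H_{\mathcal A}$ be the standard Hilbert (right) $\mathcal A$-module of all sequences $x=(x_n)_{n\in\mathbb N}$ in $\mathcal A$ for which $\sum_n x_n^*x_n$ converges in norm, with $\langle x,y\rangle=\sum_n x_n^*y_n$ and $\|x\|=\|\langle x,x\rangle\|^{1/2}$. Let $B^a(H_{\mathcal A})$ be the set of bounded adjointable $\mathcal A$-linear operators on $H_{\mathcal A}$. For $\alpha\in Z(\mathcal A)$ let $\alpha\mathrm I$ be the operator $x\mapsto x\alpha$. Write $H_{\mathcal A}=M\,\tilde\oplus\,N$ if $M,N$ are closed submodules of which $H_{\mathcal A}$ is the algebraic direct sum (not necessarily orthogonal). Isomorphisms of submodules are bounded $\mathcal A$-linear bijections with bounded inverse. A submodule is finitely generated if it is the $\mathcal A$-linear span of a finite subset. Let $\widehat{\mathcal M\Phi}{}_+^-(H_{\mathcal A})$ be the set of all $T\in B^a(H_{\mathcal A})$ for which there are decompositions $H_{\mathcal A}=M_1\tilde\oplus N_1=M_2\tilde\oplus N_2$ such that $T$ maps $M_1$ isomorphically onto $M_2$, $T(N_1)\subseteq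 N_2$, $N_1$ is finitely generated, and there are closed submodules $N_2'\subseteq N_2$ and $N$ with $N_2'\cong N_1$, $H_{\mathcal A}=N\tilde\oplus N_1=N\tilde\oplus N_2'$, and such that the projection onto $N$ along $N_2'$ is adjointable. For $F\in B^a(H_{\mathcal A})$ put $$\sigma^{\mathcal A}_{e\tilde a}(F)=\{\alpha\in Z(\mathcal A): F-\alpha\mathrm I\notin\widehat{\mathcal M\Phi}{}_+^-(H_{\mathcal A})\}.$$ Let $P^a(H_{\mathcal A})$ be the set of all $P\in B^a(H_{\mathcal A})$ with $P^2=P$ (skew projections are allowed) whose kernel is finitely generated. With $R(P)$ the range of $P$, put $$\sigma^{\mathcal A}_a(PF|_{R(P)})=\{\alpha\in Z(\mathcal A): (PF-\alpha\mathrm I)|_{R(P)}\text{ is not bounded below}\},$$ where an operator $T$ on $R(P)$ is bounded below if there is $c>0$ with $\|Tx\|\ge c\|x\|$ for all $x\in R(P)$. **Theorem.** For every $F\in B^a(H_{\mathcal A})$, $$\sigma^{\mathcal A}_{e\tilde a}(F)=\bigcap_{P\in P^a(H_{\mathcal A})}\sigma^{\mathcal A}_a(PF|_{R(P)}).$$ 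-/

import Mathlib

noncomputable section

namespace HilbertStd

section Construction

/-! ### Square-summable sequences in a C⋆-algebra -/

/- The order of the C⋆-algebra is used only inside proofs. -/
attribute [local instance] CStarAlgebra.spectralOrder CStarAlgebra.spectralOrderedRing

variable {A : Type*} [CStarAlgebra A]

/-- The series `∑ xₙ⋆ xₙ` converges in norm (for positive terms, convergence and unconditional
convergence are the same). -/
def SqSummable (x : ℕ → A) : Prop := Summable fun n => star (x n) * x n

theorem summable_of_le {a b : ℕ → A} (h0 : ∀ n, 0 ≤ a n) (hab : ∀ n, a n ≤ b n)
    (hb : Summable b) : Summable a := by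
  rw [summable_iff_vanishing_norm] at hb ⊢
  intro ε hε
  obtain ⟨s, hs⟩ := hb ε hε
  refine ⟨s, fun t ht => lt_of_le_of_lt ?_ (hs t ht)⟩
  exact CStarAlgebra.norm_le_norm_of_nonneg_of_le (Finset.sum_nonneg fun i _ => h0 i)
    (Finset.sum_le_sum fun i _ => hab i)

theorem star_add_mul_add_le (x y : A) :
    star (x + y) * (x + y) ≤ 2 • (star x * x + star y * y) := by
  have h : 0 ≤ star (x - y) * (x - y) := star_mul_self_nonneg _
  have e : 2 • (star x * x + star y * y) - star (x + y) * (x + y) = star (x - y) * (x - y) := by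
    simp only [star_add, star_sub]
    noncomm_ring
  rw [← sub_nonneg, e]
  exact h

theorem SqSummable.add {x y : ℕ → A} (hx : SqSummable x) (hy : SqSummable y) :
    SqSummable (x + y) :=
  summable_of_le (fun _ => star_mul_self_nonneg _) (fun n => star_add_mul_add_le (x n) (y n))
    ((Summable.add hx hy).const_smul 2)

theorem SqSummable.mul_right {x : ℕ → A} (hx : SqSummable x) (a : A) :
    SqSummable fun n => x n * a := by
  have := (Summable.mul_left (star a) hx).mul_right a
  refine this.congr fun n => ?_
  simp [mul_assoc]

theorem SqSummable.summable_mul {x y : ℕ → A} (hx : SqSummable x) (hy : SqSummable y) :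
    Summable fun n => star (x n) * y n := by
  have key : ∀ z : ℕ → A, SqSummable z →
      Summable fun n => star (x n) * z n + star (z n) * x n := by
    intro z hz
    refine ((Summable.sub (hx.add hz) hx).sub hz).congr fun n => ?_
    simp only [Pi.add_apply, star_add]
    noncomm_ring
  have h1 := key y hy
  have h2 := key _ (hy.mul_right (algebraMap ℂ A Complex.I))
  have h3 := (h1.sub (h2.const_smul Complex.I)).const_smul (2⁻¹ : ℂ)
  refine h3.congr fun n => ?_
  simp only [← Algebra.commutes, ← Algebra.smul_def, star_smul, mul_smul_comm, smul_mul_assoc,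
    smul_add, smul_smul]
  simp only [Complex.star_def, Complex.conj_I, mul_neg, Complex.I_mul_I]
  module

variable (A) in
/-- The square-summable sequences, as a right `A`-submodule of `ℕ → A`. -/
def sqSummableSubmodule : Submodule Aᵐᵒᵖ (ℕ → A) where
  carrier := {x | SqSummable x}
  add_mem' hx hy := SqSummable.add hx hy
  zero_mem' := by
    simp only [Set.mem_ofPred_eq, SqSummable, Pi.zero_apply, mul_zero]
    exact summable_zero
  smul_mem' a _ hx := SqSummable.mul_right hx a.unop

variable (A) in
/-- The standard Hilbert module `H_A` over the unital C⋆-algebra `A`: all sequences `(xₙ)` in `A`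
for which `∑ xₙ⋆ xₙ` converges in norm. It is a right `A`-module, that is, a module over `Aᵐᵒᵖ`,
with `(x • a)ₙ = xₙ a`. -/
def StdModule : Type _ := ↥(sqSummableSubmodule A)

namespace StdModule

instance : AddCommGroup (StdModule A) := inferInstanceAs (AddCommGroup ↥(sqSummableSubmodule A))

instance : Module Aᵐᵒᵖ (StdModule A) := inferInstanceAs (Module Aᵐᵒᵖ ↥(sqSummableSubmodule A))

instance : Module ℂ (StdModule A) := inferInstanceAs (Module ℂ ↥(sqSummableSubmodule A))

instance : IsScalarTower ℂ Aᵐᵒᵖ (StdModule A) :=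
  inferInstanceAs (IsScalarTower ℂ Aᵐᵒᵖ ↥(sqSummableSubmodule A))

/-- The `n`-th term of a sequence in `H_A`. -/
def coord (x : StdModule A) (n : ℕ) : A := x.1 n

/-- The element of `H_A` given by a square-summable sequence. -/
def mk (x : ℕ → A) (hx : SqSummable x) : StdModule A := ⟨x, hx⟩

@[simp] theorem coord_mk (x : ℕ → A) (hx : SqSummable x) (n : ℕ) : (mk x hx).coord n = x n := rfl

@[simp] theorem coord_zero (n : ℕ) : (0 : StdModule A).coord n = 0 := rfl

@[simp] theorem coord_add (x y : StdModule A) (n : ℕ) :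
    (x + y).coord n = x.coord n + y.coord n := rfl

@[simp] theorem coord_sub (x y : StdModule A) (n : ℕ) :
    (x - y).coord n = x.coord n - y.coord n := rfl

@[simp] theorem coord_op_smul (a : Aᵐᵒᵖ) (x : StdModule A) (n : ℕ) :
    (a • x).coord n = x.coord n * a.unop := rfl

@[simp] theorem coord_smul (c : ℂ) (x : StdModule A) (n : ℕ) :
    (c • x).coord n = c • x.coord n := rfl

theorem sqSummable (x : StdModule A) : SqSummable x.coord := x.2

@[ext] theorem ext {x y : StdModule A} (h : ∀ n, x.coord n = y.coord n) : x = y :=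
  Subtype.ext (funext h)

/-- The `A`-valued inner product `⟨x, y⟩ = ∑ xₙ⋆ yₙ` of `H_A`. -/
def ip (x y : StdModule A) : A := ∑' n, star (x.coord n) * y.coord n

theorem hasSum_ip (x y : StdModule A) :
    HasSum (fun n => star (x.coord n) * y.coord n) (ip x y) :=
  (x.sqSummable.summable_mul y.sqSummable).hasSum

theorem ip_add_right (x y z : StdModule A) : ip x (y + z) = ip x y + ip x z := by
  refine (hasSum_ip x (y + z)).unique (((hasSum_ip x y).add (hasSum_ip x z)).congr_fun ?_)
  intro n
  simp [mul_add]

theorem star_ip (x y : StdModule A) : star (ip x y) = ip y x := by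
  refine HasSum.unique ?_ (hasSum_ip y x)
  simpa using (hasSum_ip x y).star

theorem ip_op_smul_right (a : Aᵐᵒᵖ) (x y : StdModule A) : ip x (a • y) = ip x y * a.unop := by
  refine (hasSum_ip x (a • y)).unique ?_
  simpa [mul_assoc] using (hasSum_ip x y).mul_right a.unop

theorem ip_smul_right (c : ℂ) (x y : StdModule A) : ip x (c • y) = c • ip x y := by
  refine (hasSum_ip x (c • y)).unique ?_
  simpa using (hasSum_ip x y).const_smul c

theorem ip_add_left (x y z : StdModule A) : ip (x + y) z = ip x z + ip y z := by
  rw [← star_ip z, ip_add_right, star_add, star_ip, star_ip]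

theorem ip_op_smul_left (a : Aᵐᵒᵖ) (x y : StdModule A) :
    ip (a • x) y = star a.unop * ip x y := by
  rw [← star_ip y, ip_op_smul_right, star_mul, star_ip]

theorem ip_smul_left (c : ℂ) (x y : StdModule A) : ip (c • x) y = star c • ip x y := by
  rw [← star_ip y, ip_smul_right, star_smul, star_ip]

theorem ip_self_nonneg (x : StdModule A) : 0 ≤ ip x x :=
  (hasSum_ip x x).nonneg fun _ => star_mul_self_nonneg _

theorem coord_le_ip (x : StdModule A) (n : ℕ) : star (x.coord n) * x.coord n ≤ ip x x :=
  le_hasSum (hasSum_ip x x) n fun _ _ => star_mul_self_nonneg _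

theorem ip_self_eq_zero {x : StdModule A} : ip x x = 0 ↔ x = 0 := by
  constructor
  · intro h
    ext n
    have h1 := coord_le_ip x n
    rw [h] at h1
    exact (CStarRing.star_mul_self_eq_zero_iff _).1 (le_antisymm h1 (star_mul_self_nonneg _))
  · rintro rfl
    simp [ip]

/-- The norm `‖x‖ = ‖⟨x, x⟩‖ ^ (1 / 2)` of `H_A`. -/
instance : Norm (StdModule A) := ⟨fun x => √‖ip x x‖⟩

theorem norm_def (x : StdModule A) : ‖x‖ = √‖ip x x‖ := rfl

theorem norm_sq (x : StdModule A) : ‖x‖ ^ 2 = ‖ip x x‖ := by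
  rw [norm_def, Real.sq_sqrt (norm_nonneg _)]

theorem ip_add_self_le (x y : StdModule A) {p q : ℝ} (hp : 0 < p) (hq : 0 < q) :
    ip (x + y) (x + y) ≤ ((1 + q / p : ℝ) : ℂ) • ip x x + ((1 + p / q : ℝ) : ℂ) • ip y y := by
  set r : ℝ := √(q / p) with hr
  have hr0 : 0 < r := Real.sqrt_pos.2 (by positivity)
  have hr2 : r * r = q / p := Real.mul_self_sqrt (by positivity)
  have hr3 : r⁻¹ * r⁻¹ = p / q := by rw [← mul_inv, hr2, inv_div]
  have h := ip_self_nonneg (((r : ℝ) : ℂ) • x + (-((r⁻¹ : ℝ) : ℂ)) • y)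
  rw [← sub_nonneg]
  convert h using 1
  simp only [ip_add_right, ip_add_left, ip_smul_left, ip_smul_right, smul_add, smul_smul,
    star_neg, Complex.star_def, Complex.conj_ofReal, ← hr2, ← hr3]
  have h1 : (r : ℂ) * ((r⁻¹ : ℝ) : ℂ) = 1 := by
    rw [← Complex.ofReal_mul, mul_inv_cancel₀ hr0.ne', Complex.ofReal_one]
  have h2 : ((r⁻¹ : ℝ) : ℂ) * (r : ℂ) = 1 := by rw [mul_comm, h1]
  simp only [neg_mul, mul_neg, neg_neg, h1, h2, Complex.ofReal_add, Complex.ofReal_mul,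
    Complex.ofReal_one]
  module

theorem norm_triangle (x y : StdModule A) : ‖x + y‖ ≤ ‖x‖ + ‖y‖ := by
  by_cases hx : x = 0
  · simp [hx, norm_def, ip]
  by_cases hy : y = 0
  · simp [hy, norm_def, ip]
  have pos : ∀ z : StdModule A, z ≠ 0 → 0 < ‖z‖ := fun z hz =>
    Real.sqrt_pos.2 (norm_pos_iff.2 (fun h => hz (ip_self_eq_zero.1 h)))
  have hp := pos x hx
  have hq := pos y hy
  have h := CStarAlgebra.norm_le_norm_of_nonneg_of_le (ip_self_nonneg _)
    (ip_add_self_le x y hp hq)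
  have h' := h.trans (norm_add_le _ _)
  rw [norm_smul, norm_smul, Complex.norm_real, Complex.norm_real, ← norm_sq, ← norm_sq, ← norm_sq,
    Real.norm_of_nonneg (by positivity), Real.norm_of_nonneg (by positivity)] at h'
  refine le_of_sq_le_sq ?_ (by positivity)
  refine h'.trans (le_of_eq ?_)
  field_simp
  ring

theorem normedSpaceCore : NormedSpace.Core ℂ (StdModule A) where
  norm_nonneg _ := Real.sqrt_nonneg _
  norm_smul c x := by
    rw [norm_def, ip_smul_left, ip_smul_right, norm_smul, norm_smul, norm_star, ← mul_assoc,
      Real.sqrt_mul (by positivity), Real.sqrt_mul_self (norm_nonneg _), norm_def]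
  norm_triangle := norm_triangle
  norm_eq_zero_iff x := by
    rw [norm_def, Real.sqrt_eq_zero (norm_nonneg _), norm_eq_zero, ip_self_eq_zero]

instance : NormedAddCommGroup (StdModule A) := .ofCore normedSpaceCore

instance : NormedSpace ℂ (StdModule A) := .ofCore normedSpaceCore

theorem norm_op_smul_le (a : Aᵐᵒᵖ) (x : StdModule A) : ‖a • x‖ ≤ ‖a.unop‖ * ‖x‖ := by
  refine le_of_sq_le_sq ?_ (by positivity)
  rw [norm_sq, ip_op_smul_left, ip_op_smul_right, mul_pow, norm_sq]
  calc ‖star a.unop * (ip x x * a.unop)‖ ≤ ‖star a.unop‖ * (‖ip x x‖ * ‖a.unop‖) :=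
        (norm_mul_le _ _).trans (by gcongr; exact norm_mul_le _ _)
    _ = ‖a.unop‖ ^ 2 * ‖ip x x‖ := by rw [norm_star]; ring

theorem norm_coord_le (x : StdModule A) (n : ℕ) : ‖x.coord n‖ ≤ ‖x‖ := by
  refine le_of_sq_le_sq ?_ (norm_nonneg _)
  rw [norm_sq, sq, ← CStarRing.norm_star_mul_self]
  exact CStarAlgebra.norm_le_norm_of_nonneg_of_le (star_mul_self_nonneg _) (coord_le_ip x n)

theorem norm_sum_le (x : StdModule A) (s : Finset ℕ) :
    ‖∑ n ∈ s, star (x.coord n) * x.coord n‖ ≤ ‖x‖ ^ 2 := by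
  rw [norm_sq]
  exact CStarAlgebra.norm_le_norm_of_nonneg_of_le
    (Finset.sum_nonneg fun _ _ => star_mul_self_nonneg _)
    (sum_le_hasSum s (fun _ _ => star_mul_self_nonneg _) (hasSum_ip x x))

/-- `H_A` is complete, so that it is a Hilbert module over `A`. -/
instance : CompleteSpace (StdModule A) := by
  refine Metric.complete_of_cauchySeq_tendsto fun u hu => ?_
  have hc : ∀ n, CauchySeq fun k => (u k).coord n := by
    intro n
    rw [Metric.cauchySeq_iff] at hu ⊢
    intro ε hε
    obtain ⟨N, hN⟩ := hu ε hε
    refine ⟨N, fun k hk m hm => ?_⟩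
    have h := hN k hk m hm
    rw [dist_eq_norm] at h ⊢
    exact (norm_coord_le (u k - u m) n).trans_lt h
  choose x hx using fun n => cauchySeq_tendsto_of_complete (hc n)
  -- uniform bounds on the finite partial sums
  have hb : ∀ ε > 0, ∃ N, ∀ k ≥ N, ∀ s : Finset ℕ,
      ‖∑ n ∈ s, star (x n - (u k).coord n) * (x n - (u k).coord n)‖ ≤ ε ^ 2 := by
    intro ε hε
    obtain ⟨N, hN⟩ := Metric.cauchySeq_iff.1 hu ε hε
    refine ⟨N, fun k hk s => ?_⟩
    have ht : Filter.Tendsto (fun m => ‖∑ n ∈ s, star ((u m).coord n - (u k).coord n) *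
        ((u m).coord n - (u k).coord n)‖) Filter.atTop
        (nhds ‖∑ n ∈ s, star (x n - (u k).coord n) * (x n - (u k).coord n)‖) := by
      refine (tendsto_finsetSum s fun n _ => ?_).norm
      have h1 := (hx n).sub_const ((u k).coord n)
      exact h1.star.mul h1
    refine le_of_tendsto ht (Filter.eventually_atTop.2 ⟨N, fun m hm => ?_⟩)
    have h2 := hN m hm k hk
    rw [dist_eq_norm] at h2
    exact (norm_sum_le (u m - u k) s).trans (by gcongr)
  have hs : ∀ k, SqSummable fun n => x n - (u k).coord n := by
    intro k
    rw [SqSummable, summable_iff_vanishing_norm]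
    intro ε hε
    obtain ⟨N, hN⟩ := hb (√(ε / 4)) (Real.sqrt_pos.2 (by positivity))
    obtain ⟨s, hs⟩ := summable_iff_vanishing_norm.1 (u N - u k).sqSummable (ε / 4) (by positivity)
    refine ⟨s, fun t ht => ?_⟩
    have h1 := hN N le_rfl t
    have h2 := hs t ht
    rw [Real.sq_sqrt (by positivity)] at h1
    have h3 : ∑ n ∈ t, star (x n - (u k).coord n) * (x n - (u k).coord n) ≤
        2 • (∑ n ∈ t, star (x n - (u N).coord n) * (x n - (u N).coord n) +
          ∑ n ∈ t, star ((u N - u k).coord n) * (u N - u k).coord n) := by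
      rw [← Finset.sum_add_distrib, Finset.smul_sum]
      refine Finset.sum_le_sum fun n _ => ?_
      have h4 := star_add_mul_add_le (x n - (u N).coord n) ((u N - u k).coord n)
      simpa using h4
    have h5 := CStarAlgebra.norm_le_norm_of_nonneg_of_le
      (Finset.sum_nonneg fun _ _ => star_mul_self_nonneg _) h3
    rw [two_smul] at h5
    have h6 := (h5.trans (norm_add_le _ _)).trans
      (add_le_add (norm_add_le _ _) (norm_add_le _ _))
    linarith
  have hxs : SqSummable x := by
    have h := (hs 0).add (u 0).sqSummable
    refine h.congr fun n => ?_
    simp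
  refine ⟨mk x hxs, Metric.tendsto_atTop.2 fun ε hε => ?_⟩
  obtain ⟨N, hN⟩ := hb (ε / 2) (by positivity)
  refine ⟨N, fun k hk => ?_⟩
  rw [dist_comm, dist_eq_norm]
  refine lt_of_le_of_lt ?_ (half_lt_self hε)
  refine le_of_sq_le_sq ?_ (by positivity)
  rw [norm_sq]
  have h7 : Filter.Tendsto (fun s : Finset ℕ =>
      ‖∑ n ∈ s, star (x n - (u k).coord n) * (x n - (u k).coord n)‖) Filter.atTop
      (nhds ‖ip (mk x hxs - u k) (mk x hxs - u k)‖) :=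
    (hasSum_ip (mk x hxs - u k) (mk x hxs - u k)).norm
  exact le_of_tendsto h7 (Filter.Eventually.of_forall fun s => hN k hk s)

end StdModule

end Construction

section Operators

variable {A : Type*} [CStarAlgebra A]

/-- `T ∈ B^a(H_A)`: the bounded `A`-linear operator `T` has an adjoint. -/
def IsAdjointable (T : StdModule A →L[Aᵐᵒᵖ] StdModule A) : Prop :=
  ∃ S : StdModule A →L[Aᵐᵒᵖ] StdModule A, ∀ x y, StdModule.ip (T x) y = StdModule.ip x (S y)

/-- The operator `α I` on `H_A`, `x ↦ x α`, for `α` in the centre `Z(A)`. -/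
def centralScalar (α : Subalgebra.center ℂ A) : StdModule A →L[Aᵐᵒᵖ] StdModule A where
  toFun x := MulOpposite.op (α : A) • x
  map_add' x y := smul_add _ x y
  map_smul' a x := by
    ext n
    simp [mul_assoc, Subalgebra.mem_center_iff.1 α.2 a.unop]
  cont := by
    refine AddMonoidHomClass.continuous_of_bound
      (DistribSMul.toAddMonoidHom (StdModule A) (MulOpposite.op (α : A))) ‖(α : A)‖ fun x => ?_
    exact StdModule.norm_op_smul_le _ x

/-- `P ∈ P^a(H_A)`: `P` is an adjointable, possibly skew, projection with finitely generated
kernel. -/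
def IsAdjointableCofiniteProjection (P : StdModule A →L[Aᵐᵒᵖ] StdModule A) : Prop :=
  IsAdjointable P ∧ IsIdempotentElem P ∧
    (LinearMap.ker (P : StdModule A →ₗ[Aᵐᵒᵖ] StdModule A)).FG

/-- `H_A = M ⊕̃ N`: a direct sum of closed submodules, not necessarily orthogonal. -/
def IsDirectSum (M N : Submodule Aᵐᵒᵖ (StdModule A)) : Prop :=
  IsClosed (M : Set (StdModule A)) ∧ IsClosed (N : Set (StdModule A)) ∧ IsCompl M N

/-- With respect to the decompositions `H_A = M₁ ⊕̃ N₁ → M₂ ⊕̃ N₂ = H_A` the operator `T` has a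
diagonal matrix with entries `T₁ : M₁ → M₂` and `T₄ : N₁ → N₂`, where `T₁` is an isomorphism. -/
def IsDiagonal (T : StdModule A →L[Aᵐᵒᵖ] StdModule A)
    (M₁ N₁ M₂ N₂ : Submodule Aᵐᵒᵖ (StdModule A)) : Prop :=
  IsDirectSum M₁ N₁ ∧ IsDirectSum M₂ N₂ ∧
    (∃ e : M₁ ≃L[Aᵐᵒᵖ] M₂, ∀ x : M₁, (e x : StdModule A) = T x) ∧ ∀ x ∈ N₁, T x ∈ N₂

/-- The projection onto `M` along `N` is adjointable. -/
def HasAdjointableProjection (M N : Submodule Aᵐᵒᵖ (StdModule A)) : Prop :=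
  ∃ Q : StdModule A →L[Aᵐᵒᵖ] StdModule A,
    IsAdjointable Q ∧ (∀ x ∈ M, Q x = x) ∧ ∀ x ∈ N, Q x = 0

variable (A) in
/-- The class `\widehat{MΦ}_+^-(H_A)` of operators. -/
def MPhiHatPlusMinus : Set (StdModule A →L[Aᵐᵒᵖ] StdModule A) :=
  {T | IsAdjointable T ∧
    ∃ M₁ N₁ M₂ N₂ : Submodule Aᵐᵒᵖ (StdModule A),
      IsDiagonal T M₁ N₁ M₂ N₂ ∧ N₁.FG ∧
      ∃ N₂' N : Submodule Aᵐᵒᵖ (StdModule A),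
        N₂' ≤ N₂ ∧ Nonempty (N₂' ≃L[Aᵐᵒᵖ] N₁) ∧
        IsDirectSum N N₁ ∧ IsDirectSum N N₂' ∧ HasAdjointableProjection N N₂'}

/-- The spectrum `σ^A_{eã}(F)`, a subset of the centre of `A`. -/
def essentialSpectrum (F : StdModule A →L[Aᵐᵒᵖ] StdModule A) : Set (Subalgebra.center ℂ A) :=
  {α | F - centralScalar α ∉ MPhiHatPlusMinus A}

/-- An operator defined on a submodule is bounded below. -/
def IsBoundedBelow {M : Submodule Aᵐᵒᵖ (StdModule A)} (T : M →L[Aᵐᵒᵖ] StdModule A) : Prop :=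
  ∃ c : ℝ, 0 < c ∧ ∀ x : M, c * ‖x‖ ≤ ‖T x‖

/-- The spectrum `σ^A_a(PF|_{R(P)})`: all central `α` for which the restriction of `PF - α I` to
the range of `P` is not bounded below. -/
def compressionSpectrum (P F : StdModule A →L[Aᵐᵒᵖ] StdModule A) :
    Set (Subalgebra.center ℂ A) :=
  {α | ¬ IsBoundedBelow ((P * F - centralScalar α).comp
    (LinearMap.range (P : StdModule A →ₗ[Aᵐᵒᵖ] StdModule A)).subtypeL)}

end Operators

end HilbertStd
end

/-!
Put `G = F - α I`. Since a projection `P` is `A`-linear it commutes with `α I`, so `PF - α I`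
restricted to `R(P)` is the compression `PG|_{R(P)}`
(`HilbertStd.notMem_compressionSpectrum_iff`). The theorem therefore says that `G` belongs to
`MPhiHatPlusMinus A` if and only if some compression of `G` to the range of an adjointable
projection with finitely generated kernel is bounded below.

If `G` has a diagonal decomposition `M₁ ⊕̃ N₁ → M₂ ⊕̃ N₂` as in the definition of the class, take
for `P` the projection `Q` onto `N` along `N₂'`. Modulo `N₁` every `x ∈ N` is a vector `m ∈ M₁`,
and modulo `N₂` the vector `Q (G x)` is `G m`; since projections along closed complements are
bounded, `‖x‖ ≲ ‖m‖ ≲ ‖G m‖ ≲ ‖Q (G x)‖`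
(`HilbertStd.exists_compression_of_mem_MPhiHatPlusMinus`).

Conversely, let `PG|_{R(P)}` be bounded below. Then `T = PGP + (1 - P)` is an adjointable operator
on the whole of `H_A` which is bounded below, and such an operator has a bounded `A`-linear left
inverse `L = (T⋆T)⁻¹T⋆` (`HilbertStd.IsAdjointable.exists_leftInverse`). The operator `Λ = PLP` is a
left inverse of `G` on `R(P)` which vanishes on `ker P`, so `ΛG` and `GΛ` are idempotents, and they
give the decompositions `H_A = R(P) ⊕̃ ker (ΛG) = G(R(P)) ⊕̃ ker Λ`. Here `ker P ⊆ ker Λ`, while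
`ker (ΛG)` and `ker P` are isomorphic, being complements of the same submodule `R(P)`
(`HilbertStd.mem_MPhiHatPlusMinus_of_compression`).

The invertibility of `S = T⋆T` is obtained without the C⋆-algebra of adjointable operators: for
`t ≥ 0` the operators `S + t` are bounded below by one constant, by positivity and the
Cauchy–Schwarz inequality, so invertibility is carried from large `t` down to `t = 0` in steps of
fixed length (`HilbertStd.isUnit_of_forall_le_norm_add_smul`).
-/

namespace HilbertStd

/-! ### Invertibility by continuation -/

/-- Method of continuity: if the operators `S + t`, `t ≥ 0`, are bounded below by a common constant
`c`, then `S` is invertible. Indeed `S + t` is invertible for large `t`, and where `S + t` is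
invertible its inverse has norm at most `c⁻¹`, so `S + s` is invertible for `|s - t| < c`. -/
theorem isUnit_of_forall_le_norm_add_smul {E : Type*} [NormedAddCommGroup E] [NormedSpace ℂ E]
    [CompleteSpace E] (S : E →L[ℂ] E) {c : ℝ} (hc : 0 < c)
    (h : ∀ t : ℝ, 0 ≤ t → ∀ x, c * ‖x‖ ≤ ‖S x + (t : ℂ) • x‖) : IsUnit S := by
  have step : ∀ t s : ℝ, 0 ≤ t → |s - t| < c →
      IsUnit (S + (t : ℂ) • 1) → IsUnit (S + (s : ℂ) • 1) := by
    rintro t s ht hts ⟨u, hu⟩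
    have hinv : ‖((u⁻¹ : (E →L[ℂ] E)ˣ) : E →L[ℂ] E)‖ ≤ c⁻¹ := by
      refine ContinuousLinearMap.opNorm_le_bound _ (by positivity) fun y => ?_
      have h1 := h t ht (((u⁻¹ : (E →L[ℂ] E)ˣ) : E →L[ℂ] E) y)
      have h2 : (u : E →L[ℂ] E) (((u⁻¹ : (E →L[ℂ] E)ˣ) : E →L[ℂ] E) y) = y :=
        DFunLike.congr_fun u.mul_inv y
      rw [hu] at h2
      change S _ + (t : ℂ) • ((u⁻¹ : (E →L[ℂ] E)ˣ) : E →L[ℂ] E) y = y at h2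
      rw [h2] at h1
      rwa [inv_mul_eq_div, le_div_iff₀' hc]
    have hlt : ‖((t - s : ℝ) : ℂ) • ((u⁻¹ : (E →L[ℂ] E)ˣ) : E →L[ℂ] E)‖ < 1 := by
      rw [norm_smul, Complex.norm_real, Real.norm_eq_abs, abs_sub_comm]
      calc |s - t| * _ ≤ |s - t| * c⁻¹ := by gcongr
        _ < 1 := by rwa [← div_eq_mul_inv, div_lt_one hc]
    have heq : S + (s : ℂ) • 1 =
        u * (1 - ((t - s : ℝ) : ℂ) • ((u⁻¹ : (E →L[ℂ] E)ˣ) : E →L[ℂ] E)) := by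
      rw [mul_sub, mul_one, mul_smul_comm, u.mul_inv, hu, Complex.ofReal_sub]
      module
    rw [heq]
    exact u.isUnit.mul (isUnit_one_sub_of_norm_lt_one hlt)
  obtain ⟨n, hn⟩ := exists_nat_gt ((‖S‖ * ‖(1 : E →L[ℂ] E)‖ + 1) / (c / 2))
  have hn' : ‖S‖ * ‖(1 : E →L[ℂ] E)‖ < n * (c / 2) := by
    have := (div_lt_iff₀ (by positivity)).1 hn
    linarith
  have h0 : IsUnit (S + ((n * (c / 2) : ℝ) : ℂ) • 1) := by
    have := spectrum.mem_resolventSet_of_norm_lt_mul (𝕜 := ℂ) (a := S)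
      (k := -((n * (c / 2) : ℝ) : ℂ)) (by
        rw [norm_neg, Complex.norm_real, Real.norm_of_nonneg (by positivity)]; exact hn')
    rw [spectrum.mem_resolventSet_iff, Algebra.algebraMap_eq_smul_one] at this
    rw [← IsUnit.neg_iff]
    convert this using 1
    module
  -- Descend from `t = n * (c / 2)` to `t = 0` in steps of length `c / 2 < c`.
  have key : ∀ m : ℕ, m ≤ n → IsUnit (S + (((n - m : ℝ) * (c / 2) : ℝ) : ℂ) • 1) := by
    intro m
    induction m with
    | zero => intro _; simpa using h0
    | succ m ih =>
      intro hm
      have hm' : (m : ℝ) + 1 ≤ n := by exact_mod_cast hm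
      refine step _ _ (mul_nonneg (by linarith) (by positivity)) ?_ (ih (by omega))
      rw [← sub_mul, abs_mul, abs_of_pos (half_pos hc)]
      push_cast
      rw [show (n : ℝ) - (m + 1) - (n - m) = -1 by ring]
      norm_num
      linarith
  simpa using key n le_rfl

/-! ### Cauchy–Schwarz inequality and left inverses of adjointable operators -/

section Ordered

/- The norm estimates below use the order of the C⋆-algebra; no statement mentions it. -/
attribute [local instance] CStarAlgebra.spectralOrder CStarAlgebra.spectralOrderedRing

variable {A : Type*} [CStarAlgebra A]

namespace StdModule

theorem ip_sub_right (x y z : StdModule A) : ip x (y - z) = ip x y - ip x z := by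
  rw [eq_sub_iff_add_eq, ← ip_add_right, sub_add_cancel]

theorem ip_sub_left (x y z : StdModule A) : ip (x - y) z = ip x z - ip y z := by
  rw [eq_sub_iff_add_eq, ← ip_add_left, sub_add_cancel]

/-- The Cauchy–Schwarz inequality of the Hilbert module `H_A`. -/
theorem norm_ip_le (x y : StdModule A) : ‖ip x y‖ ≤ ‖x‖ * ‖y‖ := by
  rcases eq_or_ne x 0 with rfl | hx
  · simp [ip]
  have hp : 0 < ‖x‖ := norm_pos_iff.2 hx
  set a := ip x y with ha
  have h1 : star a * ip x x * a ≤ ‖ip x x‖ • (star a * a) :=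
    CStarAlgebra.star_left_conjugate_le_norm_smul (star_ip x x)
  have h2 : star a * a ≤ (‖x‖ ^ 2) • ip y y := by
    -- Expand `⟨xa - ‖x‖² y, xa - ‖x‖² y⟩ ≥ 0`, where `a = ⟨x, y⟩`.
    have h3 := ip_self_nonneg (MulOpposite.op a • x - ((‖x‖ ^ 2 : ℝ) : ℂ) • y)
    have h4 : ip (MulOpposite.op a • x - ((‖x‖ ^ 2 : ℝ) : ℂ) • y)
        (MulOpposite.op a • x - ((‖x‖ ^ 2 : ℝ) : ℂ) • y) =
        star a * ip x x * a - (‖x‖ ^ 2) • (star a * a) - (‖x‖ ^ 2) • (star a * a)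
          + (‖x‖ ^ 2) • (‖x‖ ^ 2) • ip y y := by
      have hyx : ip y x = star a := (star_ip x y).symm
      simp only [ip_sub_left, ip_sub_right, ip_op_smul_left, ip_op_smul_right, ip_smul_left,
        ip_smul_right, MulOpposite.unop_op, hyx, ← ha, Complex.star_def, Complex.conj_ofReal]
      simp only [Complex.coe_smul, smul_mul_assoc, mul_assoc, sub_mul, smul_sub]
      abel
    rw [h4] at h3
    rw [← norm_sq] at h1
    have h5 : 0 ≤ (‖x‖ ^ 2) • ((‖x‖ ^ 2) • ip y y - star a * a) := by
      refine h3.trans ?_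
      rw [smul_sub, ← sub_nonneg]
      have := sub_nonneg.2 h1
      convert this using 1
      abel
    have h6 := smul_nonneg (inv_nonneg.2 (sq_nonneg ‖x‖)) h5
    rwa [inv_smul_smul₀ (by positivity), sub_nonneg] at h6
  have h7 := CStarAlgebra.norm_le_norm_of_nonneg_of_le (star_mul_self_nonneg a) h2
  rw [CStarRing.norm_star_mul_self, norm_smul, ← norm_sq,
    Real.norm_of_nonneg (by positivity)] at h7
  refine le_of_sq_le_sq ?_ (by positivity)
  rw [sq, mul_pow]
  exact h7

end StdModule

open StdModule

/-- A bounded below adjointable operator `T` has the bounded `A`-linear left inverse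
`(T⋆T)⁻¹T⋆`. In particular its range is complemented, which fails for general bounded `A`-linear
operators on a Hilbert module. -/
theorem IsAdjointable.exists_leftInverse {T : StdModule A →L[Aᵐᵒᵖ] StdModule A}
    (hT : IsAdjointable T) {c : ℝ} (hc : 0 < c) (h : ∀ x, c * ‖x‖ ≤ ‖T x‖) :
    ∃ L : StdModule A →L[Aᵐᵒᵖ] StdModule A, ∀ x, L (T x) = x := by
  obtain ⟨R, hR⟩ := hT
  set S : StdModule A →L[Aᵐᵒᵖ] StdModule A := R.comp T with hS
  have hS_ip : ∀ x, ip x (S x) = ip (T x) (T x) := fun x => (hR x (T x)).symm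
  -- `c² ‖x‖² ≤ ‖⟨Tx, Tx⟩‖ ≤ ‖⟨x, (S + t) x⟩‖ ≤ ‖x‖ ‖(S + t) x‖`, as `⟨x, S x⟩ = ⟨Tx, Tx⟩ ≥ 0`.
  have hbelow : ∀ t : ℝ, 0 ≤ t → ∀ x, c ^ 2 * ‖x‖ ≤ ‖S x + (t : ℂ) • x‖ := by
    intro t ht x
    rcases eq_or_ne x 0 with rfl | hx
    · simp
    have hp : 0 < ‖x‖ := norm_pos_iff.2 hx
    have h1 : ip (T x) (T x) ≤ ip x (S x + (t : ℂ) • x) := by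
      rw [ip_add_right, hS_ip, ip_smul_right, Complex.coe_smul]
      exact le_add_of_nonneg_right (smul_nonneg ht (ip_self_nonneg x))
    have h2 := (CStarAlgebra.norm_le_norm_of_nonneg_of_le (ip_self_nonneg _) h1).trans
      (norm_ip_le _ _)
    rw [← norm_sq] at h2
    refine le_of_mul_le_mul_left ?_ hp
    calc ‖x‖ * (c ^ 2 * ‖x‖) = (c * ‖x‖) ^ 2 := by ring
      _ ≤ ‖T x‖ ^ 2 := by gcongr; exact h x
      _ ≤ _ := h2
  have hunit : IsUnit (S.restrictScalars ℂ) :=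
    isUnit_of_forall_le_norm_add_smul _ (pow_pos hc 2) hbelow
  have hbij : Function.Bijective S := by
    obtain ⟨u, hu⟩ := hunit
    have hu' : ⇑(ContinuousLinearEquiv.ofUnit u) = S := congrArg DFunLike.coe hu
    exact hu' ▸ (ContinuousLinearEquiv.ofUnit u).bijective
  let e := LinearEquiv.ofBijective (S : StdModule A →ₗ[Aᵐᵒᵖ] StdModule A) hbij
  have he : ∀ x, e x = S x := fun _ => rfl
  have hcont : Continuous e.symm := by
    refine AddMonoidHomClass.continuous_of_bound e.symm (c ^ 2)⁻¹ fun y => ?_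
    have h1 := hbelow 0 le_rfl (e.symm y)
    rw [← he, e.apply_symm_apply, Complex.ofReal_zero, zero_smul, add_zero] at h1
    rwa [inv_mul_eq_div, le_div_iff₀' (pow_pos hc 2)]
  refine ⟨ContinuousLinearMap.comp ⟨e.symm, hcont⟩ R, fun x => ?_⟩
  exact e.symm_apply_apply x

end Ordered

open StdModule

variable {A : Type*} [CStarAlgebra A]

/-! ### Adjointable operators -/

theorem IsAdjointable.add {S T : StdModule A →L[Aᵐᵒᵖ] StdModule A} (hS : IsAdjointable S)
    (hT : IsAdjointable T) : IsAdjointable (S + T) := by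
  obtain ⟨S', hS⟩ := hS
  obtain ⟨T', hT⟩ := hT
  exact ⟨S' + T', fun x y => by simp [ip_add_left, ip_add_right, hS, hT]⟩

theorem IsAdjointable.sub {S T : StdModule A →L[Aᵐᵒᵖ] StdModule A} (hS : IsAdjointable S)
    (hT : IsAdjointable T) : IsAdjointable (S - T) := by
  obtain ⟨S', hS⟩ := hS
  obtain ⟨T', hT⟩ := hT
  exact ⟨S' - T', fun x y => by simp [ip_sub_left, ip_sub_right, hS, hT]⟩

theorem IsAdjointable.mul {S T : StdModule A →L[Aᵐᵒᵖ] StdModule A} (hS : IsAdjointable S)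
    (hT : IsAdjointable T) : IsAdjointable (S * T) := by
  obtain ⟨S', hS⟩ := hS
  obtain ⟨T', hT⟩ := hT
  exact ⟨T' * S', fun x y => by simp [hS, hT]⟩

theorem isAdjointable_one : IsAdjointable (1 : StdModule A →L[Aᵐᵒᵖ] StdModule A) :=
  ⟨1, fun _ _ => rfl⟩

theorem centralScalar_apply (α : Subalgebra.center ℂ A) (x : StdModule A) :
    centralScalar α x = MulOpposite.op (α : A) • x := rfl

theorem isAdjointable_centralScalar (α : Subalgebra.center ℂ A) :
    IsAdjointable (centralScalar α) := by
  have hα : ∀ b : A, b * α = α * b := Subalgebra.mem_center_iff.1 α.2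
  have hstar : ∀ b : A, b * star (α : A) = star (α : A) * b := fun b => by
    simpa using congrArg star (hα (star b)).symm
  refine ⟨centralScalar ⟨star (α : A), Subalgebra.mem_center_iff.2 hstar⟩, fun x y => ?_⟩
  simp only [centralScalar_apply, ip_op_smul_left, ip_op_smul_right, MulOpposite.unop_op]
  exact (hstar _).symm

/-! ### Bounds and direct sums -/

theorem exists_norm_le (T : StdModule A →L[Aᵐᵒᵖ] StdModule A) :
    ∃ C : ℝ, 0 < C ∧ ∀ x, ‖T x‖ ≤ C * ‖x‖ :=
  (T.restrictScalars ℂ).bound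

/-- The projection onto `M` along `N` is bounded when both are closed. -/
theorem IsDirectSum.exists_norm_le {M N : Submodule Aᵐᵒᵖ (StdModule A)} (h : IsDirectSum M N) :
    ∃ C : ℝ, 0 < C ∧ ∀ m ∈ M, ∀ n ∈ N, ‖m‖ ≤ C * ‖m + n‖ := by
  obtain ⟨hM, hN, hc⟩ := h
  have ht : Submodule.IsTopCompl (M.restrictScalars ℂ) (N.restrictScalars ℂ) :=
    Submodule.IsCompl.isTopCompl_of_isClosed ((Submodule.isCompl_restrictScalars_iff ℂ).2 hc) hM hN
  obtain ⟨C, hC, hb⟩ := (Submodule.projectionL _ _ ht).bound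
  refine ⟨C, hC, fun m hm n hn => ?_⟩
  have h1 := hb (m + n)
  rwa [map_add, Submodule.projectionL_apply_left ht ⟨m, hm⟩,
    Submodule.projectionL_apply_right ht ⟨n, hn⟩, add_zero] at h1

theorem isDirectSum_range_ker {E : StdModule A →L[Aᵐᵒᵖ] StdModule A} (hE : IsIdempotentElem E) :
    IsDirectSum (LinearMap.range (E : StdModule A →ₗ[Aᵐᵒᵖ] StdModule A))
      (LinearMap.ker (E : StdModule A →ₗ[Aᵐᵒᵖ] StdModule A)) :=
  ⟨ContinuousLinearMap.IsIdempotentElem.isClosed_range hE, E.isClosed_ker,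
    LinearMap.IsIdempotentElem.isCompl
      (ContinuousLinearMap.IsIdempotentElem.toLinearMap hE)⟩

/-! ### Bounded below compressions -/

/-- If the compression of `G` to the range of `P` is bounded below, then so is its extension to
`H_A` by the identity on `ker P`. -/
theorem exists_bound_of_compression {G P : StdModule A →L[Aᵐᵒᵖ] StdModule A}
    (hP : IsIdempotentElem P) {c : ℝ} (hc : 0 < c)
    (h : ∀ x, P x = x → c * ‖x‖ ≤ ‖P (G x)‖) :
    ∃ d : ℝ, 0 < d ∧ ∀ x, d * ‖x‖ ≤ ‖(P * G * P + (1 - P)) x‖ := by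
  have hPP : ∀ x, P (P x) = P x := fun x => DFunLike.congr_fun hP x
  obtain ⟨C, hC, hb⟩ := exists_norm_le P
  refine ⟨(c⁻¹ * C + 1 + C)⁻¹, by positivity, fun x => ?_⟩
  set y := (P * G * P + (1 - P)) x with hy
  have hy' : y = P (G (P x)) + (x - P x) := rfl
  have h1 : P y = P (G (P x)) := by rw [hy']; simp [hPP]
  have h2 : x = P x + (y - P y) := by rw [h1, hy']; abel
  have h3 : ‖P x‖ ≤ c⁻¹ * (C * ‖y‖) := by
    rw [inv_mul_eq_div, le_div_iff₀' hc]
    refine (h _ (hPP x)).trans ?_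
    rw [← h1]
    exact hb y
  rw [inv_mul_eq_div, div_le_iff₀' (by positivity)]
  calc ‖x‖ = ‖P x + (y - P y)‖ := by rw [← h2]
    _ ≤ ‖P x‖ + (‖y‖ + ‖P y‖) := (norm_add_le _ _).trans (by gcongr; exact norm_sub_le _ _)
    _ ≤ c⁻¹ * (C * ‖y‖) + (‖y‖ + C * ‖y‖) := by gcongr; exact hb y
    _ = _ := by ring

/-- An operator with a bounded below compression `PG|_{R(P)}` belongs to the class, with respect to
`H_A = R(P) ⊕̃ ker (ΛG) → G(R(P)) ⊕̃ ker Λ = H_A`, where `Λ` is a left inverse of `G` on `R(P)`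
that vanishes on `ker P`. -/
theorem mem_MPhiHatPlusMinus_of_compression {G P : StdModule A →L[Aᵐᵒᵖ] StdModule A}
    (hG : IsAdjointable G) (hP : IsAdjointableCofiniteProjection P) {c : ℝ} (hc : 0 < c)
    (h : ∀ x, P x = x → c * ‖x‖ ≤ ‖P (G x)‖) : G ∈ MPhiHatPlusMinus A := by
  obtain ⟨hPa, hPi, hPfg⟩ := hP
  have hPP : ∀ x, P (P x) = P x := fun x => DFunLike.congr_fun hPi x
  obtain ⟨d, hd, hbelow⟩ := exists_bound_of_compression hPi hc h
  obtain ⟨L, hL⟩ := IsAdjointable.exists_leftInverse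
    (((hPa.mul hG).mul hPa).add (isAdjointable_one.sub hPa)) hd hbelow
  set Λ : StdModule A →L[Aᵐᵒᵖ] StdModule A := P * L * P with hΛ
  -- On `R(P)` the operator inverted by `L` is `PG`.
  have hΛG : ∀ x, Λ (G (P x)) = P x := by
    intro x
    have h1 : L (P (G (P (P x))) + (P x - P (P x))) = P x := hL (P x)
    rw [hPP, sub_self, add_zero] at h1
    change P (L (P (G (P x)))) = P x
    rw [h1, hPP]
  have hPΛ : ∀ x, P (Λ x) = Λ x := fun x => hPP _
  have hΛP : ∀ x, Λ (P x) = Λ x := fun x =>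
    congrArg (fun z => P (L z)) (hPP x)
  have hΛGΛ : ∀ x, Λ (G (Λ x)) = Λ x := fun x => by
    simpa only [hPΛ] using hΛG (Λ x)
  have hΛG_idem : IsIdempotentElem (Λ * G) := by
    ext1 x; exact hΛGΛ (G x)
  have hGΛ_idem : IsIdempotentElem (G * Λ) := by
    ext1 x; exact congrArg G (hΛGΛ x)
  have hrange : LinearMap.range ((Λ * G : StdModule A →L[Aᵐᵒᵖ] StdModule A) :
      StdModule A →ₗ[Aᵐᵒᵖ] StdModule A) =
      LinearMap.range (P : StdModule A →ₗ[Aᵐᵒᵖ] StdModule A) := by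
    ext x
    constructor
    · rintro ⟨y, rfl⟩
      exact ⟨Λ (G y), hPΛ _⟩
    · rintro ⟨y, rfl⟩
      exact ⟨P y, hΛG y⟩
  have hker : LinearMap.ker ((G * Λ : StdModule A →L[Aᵐᵒᵖ] StdModule A) :
      StdModule A →ₗ[Aᵐᵒᵖ] StdModule A) =
      LinearMap.ker (Λ : StdModule A →ₗ[Aᵐᵒᵖ] StdModule A) := by
    ext x
    constructor
    · intro (hx : G (Λ x) = 0)
      change Λ x = 0
      rw [← hΛGΛ, hx, map_zero]
    · intro (hx : Λ x = 0)
      change G (Λ x) = 0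
      rw [hx, map_zero]
  have hdom := isDirectSum_range_ker hΛG_idem
  have hcod := isDirectSum_range_ker hGΛ_idem
  rw [hrange] at hdom
  rw [hker] at hcod
  have hPsum := isDirectSum_range_ker hPi
  set R := LinearMap.range (P : StdModule A →ₗ[Aᵐᵒᵖ] StdModule A) with hR
  set K := LinearMap.ker (P : StdModule A →ₗ[Aᵐᵒᵖ] StdModule A) with hK
  set N₁ := LinearMap.ker ((Λ * G : StdModule A →L[Aᵐᵒᵖ] StdModule A) :
      StdModule A →ₗ[Aᵐᵒᵖ] StdModule A) with hN₁
  have mem_R : ∀ x, x ∈ R ↔ P x = x := fun x =>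
    ⟨by rintro ⟨y, rfl⟩; exact hPP y, fun hx => ⟨x, hx⟩⟩
  have mem_K : ∀ x, x ∈ K ↔ P x = 0 := fun x => Iff.rfl
  have mem_N₁ : ∀ x, x ∈ N₁ ↔ Λ (G x) = 0 := fun x => Iff.rfl
  -- `N₁` and `K` are complements of the same submodule `R`, hence isomorphic.
  let e : K ≃L[Aᵐᵒᵖ] N₁ := ContinuousLinearEquiv.equivOfInverse
    (((1 - Λ * G).comp K.subtypeL).codRestrict N₁ fun x => by
      change Λ (G ((x : StdModule A) - Λ (G x))) = 0
      rw [map_sub, map_sub, hΛGΛ, sub_self])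
    (((1 - P).comp N₁.subtypeL).codRestrict K fun x => by
      change P ((x : StdModule A) - P x) = 0
      rw [map_sub, hPP, sub_self])
    (fun x => by
      ext1
      change ((x : StdModule A) - Λ (G x)) - P ((x : StdModule A) - Λ (G x)) = x
      rw [map_sub, hPΛ, (mem_K _).1 x.2]
      abel)
    (fun x => by
      ext1
      change ((x : StdModule A) - P x) - Λ (G ((x : StdModule A) - P x)) = x
      rw [map_sub, map_sub, hΛG, (mem_N₁ _).1 x.2]
      abel)
  have hN₁fg : N₁.FG := by
    rw [← Submodule.fg_top] at hPfg ⊢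
    have h1 := hPfg.map (e : K →ₗ[Aᵐᵒᵖ] N₁)
    rwa [Submodule.map_top, LinearMap.range_eq_top.2 e.surjective] at h1
  refine ⟨hG, R, N₁, _, _, ⟨hdom, hcod, ⟨ContinuousLinearEquiv.equivOfInverse
      ((G.comp R.subtypeL).codRestrict _ fun x => ⟨G x, ?_⟩)
      ((Λ.comp (Submodule.subtypeL _)).codRestrict R fun x => (mem_R _).2 (hPΛ _)) ?_ ?_, ?_⟩, ?_⟩,
    hN₁fg, K, R, ?_, ⟨e⟩, hdom, hPsum, P, hPa, fun x => (mem_R x).1, fun x => (mem_K x).1⟩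
  · change G (Λ (G x)) = G x
    rw [← (mem_R _).1 x.2, hΛG]
  · intro x
    ext1
    change Λ (G x) = x
    rw [← (mem_R _).1 x.2, hΛG]
  · rintro ⟨_, y, rfl⟩
    ext1
    exact congrArg G (hΛGΛ y)
  · exact fun x => rfl
  · exact fun x hx => hx
  · intro x hx
    change Λ x = 0
    rw [← hΛP, (mem_K x).1 hx, map_zero]

/-- For an operator of the class, the compression to `N` along `N₂'` is bounded below. -/
theorem exists_compression_of_mem_MPhiHatPlusMinus {G : StdModule A →L[Aᵐᵒᵖ] StdModule A}
    (hG : G ∈ MPhiHatPlusMinus A) :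
    ∃ P : StdModule A →L[Aᵐᵒᵖ] StdModule A, IsAdjointableCofiniteProjection P ∧
      ∃ c : ℝ, 0 < c ∧ ∀ x, P x = x → c * ‖x‖ ≤ ‖P (G x)‖ := by
  obtain ⟨-, M₁, N₁, M₂, N₂, ⟨h₁, h₂, ⟨e, he⟩, hGN⟩, hfg, N₂', N, hle, ⟨ι⟩, hN₁, hN₂,
    Q, hQa, hQN, hQN₂⟩ := hG
  have decomp : ∀ x, ∃ n ∈ N, ∃ k ∈ N₂', n + k = x := fun x =>
    Submodule.mem_sup.1 (hN₂.2.2.sup_eq_top ▸ Submodule.mem_top)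
  have hQadd : ∀ n ∈ N, ∀ k ∈ N₂', Q (n + k) = n := fun n hn k hk => by
    rw [map_add, hQN n hn, hQN₂ k hk, add_zero]
  have hQmem : ∀ x, Q x ∈ N := fun x => by
    obtain ⟨n, hn, k, hk, rfl⟩ := decomp x
    rwa [hQadd n hn k hk]
  have hQker : LinearMap.ker (Q : StdModule A →ₗ[Aᵐᵒᵖ] StdModule A) = N₂' := by
    refine le_antisymm (fun x (hx : Q x = 0) => ?_) hQN₂
    obtain ⟨n, hn, k, hk, rfl⟩ := decomp x
    rw [hQadd n hn k hk] at hx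
    rwa [hx, zero_add]
  have hkerfg : N₂'.FG := by
    rw [← Submodule.fg_top] at hfg ⊢
    have h1 := hfg.map (ι.symm : N₁ →ₗ[Aᵐᵒᵖ] N₂')
    rwa [Submodule.map_top, LinearMap.range_eq_top.2 ι.symm.surjective] at h1
  refine ⟨Q, ⟨hQa, ContinuousLinearMap.ext fun x => hQN _ (hQmem x), hQker ▸ hkerfg⟩, ?_⟩
  obtain ⟨C₁, hC₁, hb₁⟩ := hN₁.exists_norm_le
  obtain ⟨C₂, hC₂, hb₂⟩ := h₂.exists_norm_le
  obtain ⟨C₃, hC₃, hb₃⟩ :=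
    (((M₁.subtypeL.comp (e.symm : M₂ →L[Aᵐᵒᵖ] M₁)).restrictScalars ℂ :
      M₂ →L[ℂ] StdModule A)).bound
  refine ⟨(C₁ * C₃ * C₂)⁻¹, by positivity, fun x hx => ?_⟩
  -- Modulo `N₂`, which contains `N₂'`, the vector `Q (G x)` agrees with `G x`, hence with `G m`.
  obtain ⟨m, hm, n, hn, hmn⟩ : ∃ m ∈ M₁, ∃ n ∈ N₁, m + n = x :=
    Submodule.mem_sup.1 (h₁.2.2.sup_eq_top ▸ Submodule.mem_top)
  obtain ⟨y, hy, k, hk, hyk⟩ := decomp (G x)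
  have hQG : Q (G x) = G m + (G n - k) := by
    rw [← hyk, hQadd y hy k hk, eq_sub_of_add_eq hyk, ← hmn, map_add, add_sub_assoc]
  have i₁ : ‖x‖ ≤ C₁ * ‖m‖ := by
    have := hb₁ x (hx ▸ hQmem x) (-n) (N₁.neg_mem hn)
    rwa [← hmn, add_neg_cancel_right, hmn] at this
  have i₃ : ‖m‖ ≤ C₃ * ‖G m‖ := by
    have h3 : ‖((e.symm (e ⟨m, hm⟩) : M₁) : StdModule A)‖ ≤ C₃ * ‖e ⟨m, hm⟩‖ := hb₃ (e ⟨m, hm⟩)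
    rwa [e.symm_apply_apply, Submodule.coe_norm, he] at h3
  have i₂ : ‖G m‖ ≤ C₂ * ‖Q (G x)‖ := by
    rw [hQG]
    exact hb₂ _ (he ⟨m, hm⟩ ▸ (e ⟨m, hm⟩).2) _ (N₂.sub_mem (hGN n hn) (hle hk))
  rw [inv_mul_le_iff₀ (by positivity)]
  calc ‖x‖ ≤ C₁ * (C₃ * (C₂ * ‖Q (G x)‖)) :=
        i₁.trans (by gcongr; exact i₃.trans (by gcongr))
    _ = _ := by ring

/-! ### Comparison of the spectra -/

/-- As `P` commutes with `α I`, the restriction of `PF - α I` to `R(P)` is the compression of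
`F - α I`. -/
theorem notMem_compressionSpectrum_iff {P F : StdModule A →L[Aᵐᵒᵖ] StdModule A}
    (hP : IsIdempotentElem P) (α : Subalgebra.center ℂ A) :
    α ∉ compressionSpectrum P F ↔
      ∃ c : ℝ, 0 < c ∧ ∀ x, P x = x → c * ‖x‖ ≤ ‖P ((F - centralScalar α) x)‖ := by
  have key : ∀ x, P x = x → (P * F - centralScalar α) x = P ((F - centralScalar α) x) := by
    intro x hx
    change P (F x) - centralScalar α x = P (F x - centralScalar α x)
    rw [map_sub, centralScalar_apply, map_smul, hx]
  rw [compressionSpectrum, Set.mem_ofPred_eq, not_not, IsBoundedBelow]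
  refine exists_congr fun c => and_congr_right fun _ => ⟨fun h x hx => ?_, ?_⟩
  · rw [← key x hx]
    exact h ⟨x, x, hx⟩
  · rintro h ⟨_, y, rfl⟩
    have hy : P (P y) = P y := DFunLike.congr_fun hP y
    have h1 := h _ hy
    rwa [← key _ hy] at h1

end HilbertStd

theorem theorem3p5 {A : Type*} [CStarAlgebra A]
    (F : HilbertStd.StdModule A →L[Aᵐᵒᵖ] HilbertStd.StdModule A)
    (hF : HilbertStd.IsAdjointable F) :
    HilbertStd.essentialSpectrum F =
      ⋂ (P : HilbertStd.StdModule A →L[Aᵐᵒᵖ] HilbertStd.StdModule A)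
        (_ : HilbertStd.IsAdjointableCofiniteProjection P),
        HilbertStd.compressionSpectrum P F := by
  ext α
  rw [← not_iff_not, Set.mem_iInter₂, HilbertStd.essentialSpectrum, Set.mem_ofPred_eq, not_not]
  push Not
  constructor
  · intro h
    obtain ⟨P, hP, hbelow⟩ := HilbertStd.exists_compression_of_mem_MPhiHatPlusMinus h
    exact ⟨P, hP, (HilbertStd.notMem_compressionSpectrum_iff hP.2.1 α).2 hbelow⟩
  · rintro ⟨P, hP, hα⟩
    obtain ⟨c, hc, hbelow⟩ := (HilbertStd.notMem_compressionSpectrum_iff hP.2.1 α).1 hα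
    exact HilbertStd.mem_MPhiHatPlusMinus_of_compression
      (hF.sub (HilbertStd.isAdjointable_centralScalar α)) hP hc hbelow
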